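/- Let $\Gamma$ be a weighted multidigraph with vertex set $V=\{1,\dots,n\}$, $n\ge 1$, and finitely many arcs, each carrying a real weight (negative weights are allowed, and several arcs may run from one vertex to another). Let $\varepsilon_{ij}^m$, $1\le m\le a_{ij}$, be the weights of the $a_{ij}$ arcs from $i$ to $j$. The Kirchhoff matrix of $\Gamma$ is the $n\times n$ matrix $L=(\ell_{ij})$ with $\ell_{ij}=-\sum_{m=1}^{a_{ji}}\varepsilon_{ji}^m$ for $j\ne i$ and $\ell_{ii}=-\sum_{j\ne i}\ell_{ij}$. Let $W=I+L$, and let $W^{ij}$ be the cofactor of the $(i,j)$-entry of $W$, that is, $(-1)^{i+j}$ times the determinant of the matrix obtained from $W$ by deleting row $i$ and column $j$. A spanning diverging forest of $\Gamma$ is a spanning subgraph that has no cycles when the directions of its arcs are ignored, together with one marked vertex (root) in each of its components, such that each component contains directed paths from its root to all its other vertices; these components are its trees, each diverging from its root. For $i,j\in V$ let $\mathcal F^{i\to j}$ be the set of all spanning diverging forests of $\Gamma$ in which $i$ and $j$ belong to the same tree and this tree diverges from $i$. The weight $\varepsilon(H)$ of a subgraph $H$ is the product of the weights of its arcs (equal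 to $1$ if $H$ has no arcs), and the weight of a finite set $\mathcal G$ of subgraphs is $\varepsilon(\mathcal G)=\sum_{H\in\mathcal G}\varepsilon(H)$ (equal to $0$ if $\mathcal G=\varnothing$). **Theorem.** For any weighted multidigraph $\Gamma$ and any $i,j\in V$, $$W^{ij}=\varepsilon(\mathcal F^{i\to j}).$$ -/

import Mathlib

/-- A weighted multidigraph with vertices `V` and arcs `E`: every arc `e` runs from `src e` to
`tgt e` and carries a real (possibly negative or zero) weight. Parallel arcs are distinct elements
of `E`; loops are allowed. -/
structure WeightedMultidigraph (V E : Type*) where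
  src : E → V
  tgt : E → V
  weight : E → ℝ

namespace WeightedMultidigraph

variable {V E : Type*}

/-- The total weight of the arcs from `i` to `j`. -/
noncomputable def arcWeight [DecidableEq V] [Fintype E] (Γ : WeightedMultidigraph V E) (i j : V) :
    ℝ :=
  ∑ e with Γ.src e = i ∧ Γ.tgt e = j, Γ.weight e

/-- The Kirchhoff matrix: for `i ≠ j` the `(i, j)` entry is minus the total weight of the arcs
from `j` to `i`, and the `(i, i)` entry is minus the sum of the other entries of row `i`. -/
noncomputable def kirchhoff [Fintype V] [DecidableEq V] [Fintype E]
    (Γ : WeightedMultidigraph V E) : Matrix V V ℝ :=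
  Matrix.of fun i j =>
    if i = j then -∑ k with k ≠ i, -Γ.arcWeight k i else -Γ.arcWeight j i

/-- After directions are forgotten, the arc `e` is an edge between `u` and `v`. -/
def Joins (Γ : WeightedMultidigraph V E) (e : E) (u v : V) : Prop :=
  (Γ.src e = u ∧ Γ.tgt e = v) ∨ (Γ.src e = v ∧ Γ.tgt e = u)

/-- `u` and `v` lie in the same component of the spanning subgraph with arc set `F`
(directions forgotten). -/
def SameComponent (Γ : WeightedMultidigraph V E) (F : Finset E) (u v : V) : Prop :=
  Relation.ReflTransGen (fun a b => ∃ e ∈ F, Γ.Joins e a b) u v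

/-- The spanning subgraph with arc set `F` contains a directed path from `u` to `v`
(the trivial one if `u = v`). -/
def Reaches (Γ : WeightedMultidigraph V E) (F : Finset E) (u v : V) : Prop :=
  Relation.ReflTransGen (fun a b => ∃ e ∈ F, Γ.src e = a ∧ Γ.tgt e = b) u v

/-- With directions forgotten, `v 0, e 0, v 1, e 1, …, e (k - 1), v k = v 0` is a cycle of
length `k` in the multigraph with edge set `F`. A loop is a cycle of length `1`, and two distinct
edges between the same two distinct vertices form a cycle of length `2`. -/
def IsCycle (Γ : WeightedMultidigraph V E) (F : Finset E) (k : ℕ) (v : ℕ → V) (e : ℕ → E) :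
    Prop :=
  0 < k ∧ v k = v 0 ∧ Set.InjOn v (Set.Iio k) ∧ Set.InjOn e (Set.Iio k) ∧
    ∀ t < k, e t ∈ F ∧ Γ.Joins (e t) (v t) (v (t + 1))

/-- With directions forgotten, the spanning subgraph with arc set `F` is a forest. -/
def IsForest (Γ : WeightedMultidigraph V E) (F : Finset E) : Prop :=
  ∀ (k : ℕ) (v : ℕ → V) (e : ℕ → E), ¬ Γ.IsCycle F k v e

/-- The spanning subgraph with arc set `F` and set of marked vertices (roots) `R` is a diverging
forest: it is a forest, every component has exactly one root, and every component contains
directed paths from its root to all of its vertices. -/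
structure IsDivergingForest (Γ : WeightedMultidigraph V E) (F : Finset E) (R : Finset V) :
    Prop where
  forest : Γ.IsForest F
  root : ∀ v : V, ∃! r : V, r ∈ R ∧ Γ.SameComponent F r v
  diverging : ∀ r ∈ R, ∀ v : V, Γ.SameComponent F r v → Γ.Reaches F r v

open Classical in
/-- The spanning diverging forests (arc set, set of roots) in which `i` and `j` belong to the same
tree and this tree diverges from `i`. -/
noncomputable def divergingForests [Fintype V] [Fintype E] (Γ : WeightedMultidigraph V E)
    (i j : V) : Finset (Finset E × Finset V) :=
  Finset.univ.filter fun H =>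
    Γ.IsDivergingForest H.1 H.2 ∧ i ∈ H.2 ∧ Γ.SameComponent H.1 i j

/-- The weight of a subgraph with arc set `F`: the product of the weights of its arcs. -/
noncomputable def subgraphWeight (Γ : WeightedMultidigraph V E) (F : Finset E) : ℝ :=
  ∏ e ∈ F, Γ.weight e

/-- The weight of a finite set of rooted spanning subgraphs: the sum of their weights. -/
noncomputable def totalWeight (Γ : WeightedMultidigraph V E) (S : Finset (Finset E × Finset V)) : ℝ :=
  ∑ H ∈ S, Γ.subgraphWeight H.1

end WeightedMultidigraph

/-- The cofactor of the `(i, j)` entry of a square matrix: the signed determinant of the matrix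
obtained by deleting row `i` and column `j`. -/
noncomputable def cofactor {n : ℕ} (A : Matrix (Fin (n + 1)) (Fin (n + 1)) ℝ) (i j : Fin (n + 1)) : ℝ :=
  (-1) ^ ((i : ℕ) + (j : ℕ)) * (A.submatrix i.succAbove j.succAbove).det

namespace WeightedMultidigraph

section Forests

variable {V E : Type*} {Γ : WeightedMultidigraph V E}

lemma Reaches.sameComponent {F : Finset E} {u v : V} (h : Γ.Reaches F u v) :
    Γ.SameComponent F u v :=
  Relation.ReflTransGen.mono (fun _ _ ⟨e, he, h⟩ => ⟨e, he, Or.inl h⟩) _ _ h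

lemma SameComponent.symm {F : Finset E} {u v : V} (h : Γ.SameComponent F u v) :
    Γ.SameComponent F v u :=
  have : Std.Symm fun a b => ∃ e ∈ F, Γ.Joins e a b := ⟨fun _ _ ⟨e, he, h⟩ => ⟨e, he, h.symm⟩⟩
  Relation.ReflTransGen.stdSymm.symm _ _ h

lemma Joins.sym2_eq {e : E} {a b a' b' : V} (h : Γ.Joins e a b) (h' : Γ.Joins e a' b') :
    (a = a' ∧ b = b') ∨ (a = b' ∧ b = a') := by
  unfold Joins at h h'
  grind

/-- Every arc of a forest is a bridge. -/
lemma IsForest.not_sameComponent_erase [DecidableEq E] {F : Finset E} (hF : Γ.IsForest F) {e : E}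
    (he : e ∈ F) : ¬ Γ.SameComponent (F.erase e) (Γ.tgt e) (Γ.src e) := by
  classical
  intro h
  let G : SimpleGraph V := SimpleGraph.fromRel fun a b => ∃ f ∈ F.erase e, Γ.Joins f a b
  have hG : ∀ {a b}, G.Adj a b → ∃ f ∈ F.erase e, Γ.Joins f a b := by
    rintro a b ⟨-, h | ⟨f, hf, h⟩⟩
    · exact h
    · exact ⟨f, hf, h.symm⟩
  have hr : G.Reachable (Γ.tgt e) (Γ.src e) := by
    refine Relation.ReflTransGen.trans_induction_on
      (motive := fun {a b} _ => G.Reachable a b) h (fun a => .refl a) ?_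
      (fun _ _ h₁ h₂ => h₁.trans h₂)
    intro a b hab
    by_cases hne : a = b
    · exact hne ▸ .refl a
    · exact SimpleGraph.Adj.reachable ⟨hne, Or.inl hab⟩
  obtain ⟨p, hp⟩ := hr.exists_isPath
  have hadj : ∀ t, t < p.length →
      ∃ f ∈ F.erase e, Γ.Joins f (p.getVert t) (p.getVert (t + 1)) :=
    fun t ht => hG (p.adj_getVert_succ ht)
  have hinj := hp.getVert_injOn
  have : Nonempty E := ⟨e⟩
  choose! f hf hj using hadj
  refine hF (p.length + 1) (fun t => if t ≤ p.length then p.getVert t else Γ.tgt e)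
    (fun t => if t < p.length then f t else e) ⟨by omega, by simp, ?_, ?_, ?_⟩
  · intro s hs t ht hst
    simp only [Set.mem_Iio, Nat.lt_succ_iff] at hs ht
    simp only [hs, ht, if_true] at hst
    exact hinj hs ht hst
  · intro s hs t ht hst
    simp only [Set.mem_Iio, Nat.lt_succ_iff] at hs ht
    rcases hs.lt_or_eq with hs | hs <;> rcases ht.lt_or_eq with ht | ht
    · simp only [hs, ht, if_true] at hst
      have h₁ := hj s hs
      rw [hst] at h₁
      rcases h₁.sym2_eq (hj t ht) with ⟨h₁, -⟩ | ⟨h₁, h₂⟩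
      · exact hinj (show s ≤ _ by omega) (show t ≤ _ by omega) h₁
      · have h₃ := hinj (show s ≤ _ by omega) (show t + 1 ≤ _ by omega) h₁
        have h₄ := hinj (show s + 1 ≤ _ by omega) (show t ≤ _ by omega) h₂
        omega
    · simp only [hs, ht, if_true, lt_irrefl, if_false] at hst
      exact absurd hst (Finset.ne_of_mem_erase (hf s hs))
    · simp only [hs, ht, if_true, lt_irrefl, if_false] at hst
      exact absurd hst.symm (Finset.ne_of_mem_erase (hf t ht))
    · omega
  · intro t ht
    rcases (Nat.lt_succ_iff.1 ht).lt_or_eq with ht | rfl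
    · simpa [ht, ht.le, Nat.succ_le_of_lt ht] using
        And.intro (Finset.mem_of_mem_erase (hf t ht)) (hj t ht)
    · have : Γ.Joins e (Γ.src e) (Γ.tgt e) := .inl ⟨rfl, rfl⟩
      simpa [he] using this

/-- A directed path either avoids the arc `e` or can be cut at `e`. -/
lemma Reaches.erase_or [DecidableEq E] {F : Finset E} {u v : V} (h : Γ.Reaches F u v) (e : E) :
    Γ.Reaches (F.erase e) u v ∨
      (Γ.Reaches (F.erase e) u (Γ.src e) ∧ Γ.Reaches F (Γ.tgt e) v) := by
  induction h with
  | refl => exact .inl .refl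
  | @tail w w' _ hf ih =>
    obtain ⟨f, hfF, hfs, hft⟩ := hf
    rcases ih with ih | ⟨ih₁, ih₂⟩
    · by_cases hfe : f = e
      · subst hfe
        subst hfs hft
        exact .inr ⟨ih, .refl⟩
      · exact .inl (ih.tail ⟨f, Finset.mem_erase.2 ⟨hfe, hfF⟩, hfs, hft⟩)
    · exact .inr ⟨ih₁, ih₂.tail ⟨f, hfF, hfs, hft⟩⟩

/-- A forest contains no directed cycle. -/
lemma IsForest.not_reaches {F : Finset E} (hF : Γ.IsForest F) {e : E} (he : e ∈ F) :
    ¬ Γ.Reaches F (Γ.tgt e) (Γ.src e) := by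
  classical
  intro h
  rcases h.erase_or e with h | ⟨h, -⟩ <;>
    exact hF.not_sameComponent_erase he h.sameComponent

lemma mem_divergingForests [Fintype V] [Fintype E] {i j : V} {H : Finset E × Finset V} :
    H ∈ Γ.divergingForests i j ↔
      Γ.IsDivergingForest H.1 H.2 ∧ i ∈ H.2 ∧ Γ.SameComponent H.1 i j := by
  simp [divergingForests]

namespace IsDivergingForest

variable {F : Finset E} {R : Finset V}

lemma exists_reaches (h : Γ.IsDivergingForest F R) (v : V) : ∃ r ∈ R, Γ.Reaches F r v := by
  obtain ⟨r, ⟨hr, hc⟩, -⟩ := h.root v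
  exact ⟨r, hr, h.diverging r hr v hc⟩

lemma tgt_notMem (h : Γ.IsDivergingForest F R) {e : E} (he : e ∈ F) : Γ.tgt e ∉ R := fun hR =>
  h.forest.not_reaches he <| h.diverging _ hR _ <| .single ⟨e, he, .inr ⟨rfl, rfl⟩⟩

lemma exists_tgt_eq (h : Γ.IsDivergingForest F R) {v : V} (hv : v ∉ R) :
    ∃ e ∈ F, Γ.tgt e = v := by
  obtain ⟨r, hr, hrv⟩ := h.exists_reaches v
  rcases Relation.ReflTransGen.cases_tail hrv with rfl | ⟨w, -, e, he, -, rfl⟩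
  · exact absurd hr hv
  · exact ⟨e, he, rfl⟩

lemma tgt_injOn (h : Γ.IsDivergingForest F R) : Set.InjOn Γ.tgt (F : Set E) := by
  classical
  intro e he e' he' heq
  by_contra hne
  rw [Finset.mem_coe] at he he'
  obtain ⟨r, hr, hrv⟩ := h.exists_reaches (Γ.tgt e)
  have reach : ∀ {f}, f ∈ F → Γ.tgt f = Γ.tgt e → Γ.Reaches F r (Γ.src f) := fun {f} hf hfe =>
    h.diverging r hr _ (hrv.sameComponent.tail ⟨f, hf, .inr ⟨rfl, hfe⟩⟩)
  have h₁ : Γ.Reaches (F.erase e) r (Γ.src e) := by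
    rcases (reach he rfl).erase_or e with h₁ | ⟨h₁, -⟩ <;> exact h₁
  have h₂ : Γ.Reaches (F.erase e) r (Γ.src e') := by
    rcases (reach he' heq.symm).erase_or e with h₂ | ⟨-, h₂⟩
    · exact h₂
    · exact absurd (heq ▸ h₂) (h.forest.not_reaches he')
  have h₃ : Γ.Reaches (F.erase e) r (Γ.tgt e) :=
    h₂.tail ⟨e', Finset.mem_erase.2 ⟨fun h => hne h.symm, he'⟩, rfl, heq.symm⟩
  exact h.forest.not_sameComponent_erase he (h₃.sameComponent.symm.trans h₁.sameComponent)

end IsDivergingForest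

end Forests

section Choices

variable {V E : Type*} {Γ : WeightedMultidigraph V E}

/-- `c` selects for every vertex at most one arc entering it. -/
def IsArcChoice (Γ : WeightedMultidigraph V E) (c : V → Option E) : Prop :=
  ∀ v e, c v = some e → Γ.tgt e = v

open Classical in
/-- The arcs selected by `c`. -/
noncomputable def chosenArcs [Fintype E] (Γ : WeightedMultidigraph V E) (c : V → Option E) :
    Finset E :=
  {e | c (Γ.tgt e) = some e}

open Classical in
/-- The vertices for which `c` selects no arc. -/
noncomputable def choiceRoots [Fintype V] (c : V → Option E) : Finset V :=
  {v | c v = none}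

/-- Every vertex is reached from a vertex without selected arc. -/
def IsGrounded [Fintype E] (Γ : WeightedMultidigraph V E) (c : V → Option E) : Prop :=
  ∀ v, ∃ r, c r = none ∧ Γ.Reaches (Γ.chosenArcs c) r v

@[simp] lemma mem_choiceRoots [Fintype V] {c : V → Option E} {v : V} :
    v ∈ choiceRoots c ↔ c v = none := by
  simp [choiceRoots]

variable [Fintype E] {c : V → Option E}

@[simp] lemma mem_chosenArcs {e : E} : e ∈ Γ.chosenArcs c ↔ c (Γ.tgt e) = some e := by
  simp [chosenArcs]

namespace IsArcChoice

lemma mem_chosenArcs (hc : Γ.IsArcChoice c) {v : V} {e : E} (h : c v = some e) :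
    e ∈ Γ.chosenArcs c := by
  simp [hc v e h, h]

lemma reaches_src (hc : Γ.IsArcChoice c) {v : V} {e : E} (h : c v = some e) :
    Γ.Reaches (Γ.chosenArcs c) (Γ.src e) v :=
  .single ⟨e, hc.mem_chosenArcs h, rfl, hc v e h⟩

end IsArcChoice

lemma Reaches.eq_of_choice_eq_none {r v : V} (h : Γ.Reaches (Γ.chosenArcs c) r v)
    (hv : c v = none) : v = r := by
  rcases Relation.ReflTransGen.cases_tail h with rfl | ⟨w, -, e, he, -, rfl⟩
  · rfl
  · simp [hv] at he

lemma Reaches.src_of_choice {r v : V} {e : E} (h : Γ.Reaches (Γ.chosenArcs c) r v)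
    (hr : c r = none) (hv : c v = some e) : Γ.Reaches (Γ.chosenArcs c) r (Γ.src e) := by
  rcases Relation.ReflTransGen.cases_tail h with rfl | ⟨w, hw, f, hf, rfl, rfl⟩
  · simp [hr] at hv
  · obtain rfl : f = e := by simpa [hv, eq_comm] using hf
    exact hw

lemma reaches_iff_reaches_src (hc : Γ.IsArcChoice c) {r v : V} {e : E} (hr : c r = none)
    (hv : c v = some e) :
    Γ.Reaches (Γ.chosenArcs c) r v ↔ Γ.Reaches (Γ.chosenArcs c) r (Γ.src e) :=
  ⟨fun h => h.src_of_choice hr hv, fun h => h.trans (hc.reaches_src hv)⟩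

lemma SameComponent.reaches_of_choice {r v : V} (h : Γ.SameComponent (Γ.chosenArcs c) r v)
    (hr : c r = none) : Γ.Reaches (Γ.chosenArcs c) r v := by
  induction h with
  | refl => exact .refl
  | tail _ hf ih =>
    obtain ⟨f, hf, ⟨rfl, rfl⟩ | ⟨rfl, rfl⟩⟩ := hf
    · exact ih.tail ⟨f, hf, rfl, rfl⟩
    · exact ih.src_of_choice hr (by simpa using hf)

lemma Reaches.root_unique {r r' v : V} (h : Γ.Reaches (Γ.chosenArcs c) r v)
    (h' : Γ.Reaches (Γ.chosenArcs c) r' v) (hr : c r = none) (hr' : c r' = none) : r = r' := by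
  induction h with
  | refl => exact h'.eq_of_choice_eq_none hr
  | tail _ hf ih =>
    obtain ⟨f, hf, rfl, rfl⟩ := hf
    exact ih (h'.src_of_choice hr' (by simpa using hf))

lemma IsGrounded.wellFounded (hg : Γ.IsGrounded c) :
    WellFounded fun u v => ∃ e, c v = some e ∧ Γ.src e = u := by
  refine ⟨fun v => ?_⟩
  obtain ⟨r, hr, h⟩ := hg v
  induction h with
  | refl => exact ⟨_, fun _ ⟨e, he, _⟩ => by simp [hr] at he⟩
  | tail _ hf ih =>
    obtain ⟨f, hf, rfl, rfl⟩ := hf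
    refine ⟨_, ?_⟩
    rintro _ ⟨e, he, rfl⟩
    obtain rfl : f = e := by simpa [he, eq_comm] using hf
    exact ih

lemma IsGrounded.exists_depth [Finite V] (hg : Γ.IsGrounded c) :
    ∃ d : V → ℕ, ∀ v e, c v = some e → d (Γ.src e) < d v := by
  have hwf := hg.wellFounded.transGen
  refine ⟨fun v => {u | Relation.TransGen (fun u v => ∃ e, c v = some e ∧ Γ.src e = u) u v}.ncard,
    fun v e he => Set.ncard_lt_ncard ?_ (Set.toFinite _)⟩
  refine Set.ssubset_iff_of_subset (fun u hu => hu.tail ⟨e, he, rfl⟩) |>.2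
    ⟨Γ.src e, .single ⟨e, he, rfl⟩, fun h => ?_⟩
  exact hwf.irrefl.irrefl _ h

lemma IsGrounded.isForest [Finite V] (hg : Γ.IsGrounded c) : Γ.IsForest (Γ.chosenArcs c) := by
  obtain ⟨d, hd⟩ := hg.exists_depth
  rintro k v e ⟨hk, hv, -, he, hj⟩
  have hlt : ∀ f ∈ Γ.chosenArcs c, d (Γ.src f) < d (Γ.tgt f) := fun f hf =>
    hd _ _ (by simpa using hf)
  obtain ⟨t, ht, hmax⟩ := Finset.exists_max_image (Finset.range k) (fun t => d (v t))
    ⟨0, by simpa using hk⟩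
  rw [Finset.mem_range] at ht
  have hmax' : ∀ s ≤ k, d (v s) ≤ d (v t) := by
    intro s hs
    rcases hs.lt_or_eq with hs | rfl
    · exact hmax s (by simpa using hs)
    · rw [hv]; exact hmax 0 (by simpa using hk)
  have key : ∀ s < k, v s = v t ∨ v (s + 1) = v t → c (v t) = some (e s) := by
    intro s hs hst
    obtain ⟨hF, hjs⟩ := hj s hs
    have h₁ := hlt _ hF
    have h₂ := hmax' s hs.le
    have h₃ := hmax' (s + 1) hs
    rw [mem_chosenArcs] at hF
    suffices Γ.tgt (e s) = v t by rw [← this]; exact hF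
    rcases hjs with ⟨h, h'⟩ | ⟨h, h'⟩ <;> rw [h, h'] at h₁ <;> rw [h'] <;>
      rcases hst with hst | hst <;> first | exact hst | (rw [hst] at h₁; omega)
  have hloop : ∀ s < k, v s ≠ v (s + 1) := by
    intro s hs h
    obtain ⟨hF, ⟨h₁, h₂⟩ | ⟨h₁, h₂⟩⟩ := hj s hs <;>
      exact absurd (hlt _ hF) (by rw [h₁, h₂, h]; exact lt_irrefl _)
  have h₁ := key t ht (.inl rfl)
  rcases Nat.eq_zero_or_pos t with rfl | hpos
  · have h₂ := key (k - 1) (by omega) (.inr (by rw [Nat.sub_add_cancel hk, hv]))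
    have := he (show 0 ∈ Set.Iio k from hk) (show k - 1 ∈ Set.Iio k from Nat.sub_lt hk one_pos)
      (Option.some.inj (h₁.symm.trans h₂))
    obtain rfl : k = 1 := by omega
    exact hloop 0 one_pos hv.symm
  · have h₂ := key (t - 1) (by omega) (.inr (by rw [Nat.sub_add_cancel hpos]))
    have := he (show t ∈ Set.Iio k from ht) (show t - 1 < k by omega)
      (Option.some.inj (h₁.symm.trans h₂))
    omega

lemma IsGrounded.isDivergingForest [Fintype V] (hg : Γ.IsGrounded c) :
    Γ.IsDivergingForest (Γ.chosenArcs c) (choiceRoots c) where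
  forest := hg.isForest
  root v := by
    obtain ⟨r, hr, h⟩ := hg v
    refine ⟨r, ⟨by simpa using hr, h.sameComponent⟩, ?_⟩
    rintro r' ⟨hr', h'⟩
    rw [mem_choiceRoots] at hr'
    exact (h'.reaches_of_choice hr').root_unique h hr' hr
  diverging r hr v h := h.reaches_of_choice (by simpa using hr)

/-- A diverging forest is given by selecting the arc that enters each vertex other than the
roots. -/
lemma IsDivergingForest.exists_choice [Fintype V] {F : Finset E} {R : Finset V}
    (h : Γ.IsDivergingForest F R) :
    ∃ c, Γ.IsArcChoice c ∧ Γ.IsGrounded c ∧ Γ.chosenArcs c = F ∧ choiceRoots c = R := by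
  classical
  let c : V → Option E := fun v => if hv : ∃ e ∈ F, Γ.tgt e = v then some hv.choose else none
  have hsome : ∀ v e, c v = some e ↔ e ∈ F ∧ Γ.tgt e = v := by
    intro v e
    by_cases hv : ∃ e ∈ F, Γ.tgt e = v
    · simp only [c, hv, dif_pos, Option.some.injEq]
      have hs := hv.choose_spec
      refine ⟨fun h => h ▸ hs, fun he => h.tgt_injOn hs.1 he.1 (hs.2.trans he.2.symm)⟩
    · simp only [c, hv, dif_neg, not_false_eq_true, reduceCtorEq, false_iff]
      exact fun he => hv ⟨e, he⟩
  have hF : Γ.chosenArcs c = F := by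
    ext e
    simp [hsome]
  have hR : choiceRoots c = R := by
    ext v
    rw [mem_choiceRoots]
    constructor
    · intro hv
      by_contra hvR
      obtain ⟨e, he⟩ := h.exists_tgt_eq hvR
      simp [(hsome v e).2 he] at hv
    · intro hv
      rw [Option.eq_none_iff_forall_ne_some]
      intro e he
      obtain ⟨heF, rfl⟩ := (hsome v e).1 he
      exact h.tgt_notMem heF hv
  refine ⟨c, fun v e he => ((hsome v e).1 he).2, fun v => ?_, hF, hR⟩
  obtain ⟨r, hr, hrv⟩ := h.exists_reaches v
  exact ⟨r, by simpa [← hR] using hr, hF ▸ hrv⟩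

lemma IsArcChoice.ext {c' : V → Option E} (hc : Γ.IsArcChoice c) (hc' : Γ.IsArcChoice c')
    (h : Γ.chosenArcs c = Γ.chosenArcs c') : c = c' := by
  funext v
  refine Option.ext fun e => ⟨fun he => ?_, fun he => ?_⟩
  · have := h ▸ hc.mem_chosenArcs he
    rwa [WeightedMultidigraph.mem_chosenArcs, hc v e he] at this
  · have := h.symm ▸ hc'.mem_chosenArcs he
    rwa [WeightedMultidigraph.mem_chosenArcs, hc' v e he] at this

lemma IsArcChoice.subgraphWeight_chosenArcs [Fintype V] (hc : Γ.IsArcChoice c) :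
    Γ.subgraphWeight (Γ.chosenArcs c) = ∏ v, (c v).elim 1 Γ.weight := by
  classical
  unfold subgraphWeight
  rw [← Finset.prod_subset (Finset.subset_univ {v | c v ≠ none})]
  · refine Finset.prod_bij (fun e _ => Γ.tgt e) ?_ ?_ ?_ ?_
    · intro e he
      simp [WeightedMultidigraph.mem_chosenArcs.1 he]
    · intro e he f hf hef
      rw [WeightedMultidigraph.mem_chosenArcs] at he hf
      rw [hef, hf] at he
      exact (Option.some.inj he).symm
    · intro v hv
      obtain ⟨e, he⟩ := Option.ne_none_iff_exists'.1 (Finset.mem_filter.1 hv).2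
      exact ⟨e, hc.mem_chosenArcs he, hc v e he⟩
    · intro e he
      simp [WeightedMultidigraph.mem_chosenArcs.1 he]
  · intro v _ hv
    have hv : c v = none := by simpa using hv
    simp [hv]

end Choices

section Determinants

open Matrix

variable {V E : Type*} [Fintype V] [DecidableEq V] {Γ : WeightedMultidigraph V E}
  {c : V → Option E}

/-- The matrix whose row `v` is `e_v - e_u` if `c` selects an arc from `u` for `v`, and `e_v` if
`c` selects no arc for `v`. -/
noncomputable def choiceMatrix (Γ : WeightedMultidigraph V E) (c : V → Option E) : Matrix V V ℝ :=
  Matrix.of fun v => Pi.single v 1 - (c v).elim 0 fun e => Pi.single (Γ.src e) 1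

lemma choiceMatrix_mulVec (x : V → ℝ) (v : V) :
    (Γ.choiceMatrix c *ᵥ x) v = x v - (c v).elim 0 fun e => x (Γ.src e) := by
  change (Pi.single v 1 - (c v).elim 0 fun e => Pi.single (Γ.src e) 1) ⬝ᵥ x = _
  cases c v <;> simp [sub_dotProduct]

variable [Fintype E]

open Classical in
lemma det_choiceMatrix (hc : Γ.IsArcChoice c) :
    (Γ.choiceMatrix c).det = if Γ.IsGrounded c then 1 else 0 := by
  split_ifs with hg
  · obtain ⟨d, hd⟩ := hg.exists_depth
    have hdiag : ∀ v, Γ.choiceMatrix c v v = 1 := by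
      intro v
      cases h : c v with
      | none => simp [choiceMatrix, h]
      | some e =>
        have hne : v ≠ Γ.src e := fun hv => (hd v e h).ne (by rw [← hv])
        simp [choiceMatrix, h, hne]
    have hoff : ∀ v u, Γ.choiceMatrix c v u ≠ 0 → d u ≤ d v := by
      intro v u hvu
      rcases eq_or_ne u v with rfl | huv
      · exact le_rfl
      cases h : c v with
      | none => simp [choiceMatrix, h, huv] at hvu
      | some e =>
        obtain rfl : u = Γ.src e := by
          by_contra hue
          simp [choiceMatrix, h, huv, hue] at hvu
        exact (hd v e h).le
    have hoff' : ∀ v u, u ≠ v → d v = d u → Γ.choiceMatrix c v u = 0 := by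
      intro v u huv hduv
      cases h : c v with
      | none => simp [choiceMatrix, h, huv]
      | some e =>
        have hne : u ≠ Γ.src e := by
          rintro rfl
          exact (hd v e h).ne hduv.symm
        simp [choiceMatrix, h, huv, hne]
    rw [← det_transpose, det_apply', Finset.sum_eq_single 1]
    · simp [hdiag]
    · intro σ _ hσ
      by_contra hne
      have hne' : ∀ v, Γ.choiceMatrix c v (σ v) ≠ 0 := by
        intro v
        have := Finset.prod_ne_zero_iff.1 (right_ne_zero_of_mul hne) v (Finset.mem_univ v)
        simpa using this
      have hsum : ∑ v, d (σ v) = ∑ v, d v := Equiv.sum_comp σ d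
      have heq := (Finset.sum_eq_sum_iff_of_le fun v _ => hoff v (σ v) (hne' v)).1 hsum
      refine hσ (Equiv.ext fun v => ?_)
      by_contra hv
      exact hne' v (hoff' v (σ v) hv (heq v (Finset.mem_univ v)).symm)
    · simp
  · unfold IsGrounded at hg
    push Not at hg
    obtain ⟨v, hv⟩ := hg
    refine exists_mulVec_eq_zero_iff.1
      ⟨fun u => if ∃ r, c r = none ∧ Γ.Reaches (Γ.chosenArcs c) r u then 0 else 1, ?_, ?_⟩
    · intro h
      have := congrFun h v
      rw [if_neg (by push Not; exact hv)] at this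
      exact one_ne_zero this
    · funext u
      rw [choiceMatrix_mulVec]
      cases h : c u with
      | none =>
        have : ∃ r, c r = none ∧ Γ.Reaches (Γ.chosenArcs c) r u := ⟨u, h, .refl⟩
        simp [this]
      | some e =>
        have : (∃ r, c r = none ∧ Γ.Reaches (Γ.chosenArcs c) r u) ↔
            ∃ r, c r = none ∧ Γ.Reaches (Γ.chosenArcs c) r (Γ.src e) :=
          exists_congr fun r => and_congr_right fun hr => reaches_iff_reaches_src hc hr h
        simp [this]

open Classical in
lemma adjugate_choiceMatrix (hc : Γ.IsArcChoice c) {i : V} (hi : c i = none) (j : V) :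
    (Γ.choiceMatrix c).adjugate j i =
      if Γ.IsGrounded c ∧ Γ.Reaches (Γ.chosenArcs c) i j then 1 else 0 := by
  let x : V → ℝ := fun v => if Γ.Reaches (Γ.chosenArcs c) i v then 1 else 0
  have hx : Γ.choiceMatrix c *ᵥ x = Pi.single i 1 := by
    funext v
    rw [choiceMatrix_mulVec]
    cases h : c v with
    | none =>
      by_cases hiv : v = i
      · subst hiv
        have : Γ.Reaches (Γ.chosenArcs c) v v := .refl
        simp [x, this]
      · have : ¬ Γ.Reaches (Γ.chosenArcs c) i v := fun h' => hiv (h'.eq_of_choice_eq_none h)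
        simp [x, this, hiv]
    | some e =>
      have hiv : v ≠ i := by
        rintro rfl
        simp [hi] at h
      simp [x, reaches_iff_reaches_src hc hi h, hiv]
  have h := congrFun (congrArg ((Γ.choiceMatrix c).adjugate *ᵥ ·) hx) j
  simp only [mulVec_mulVec, adjugate_mul, smul_mulVec, one_mulVec, Pi.smul_apply, smul_eq_mul,
    mulVec_single_one, col_apply] at h
  rw [← h, det_choiceMatrix hc, ite_and, ite_mul, one_mul, zero_mul]

lemma one_add_kirchhoff_apply (v : V) :
    (1 + Γ.kirchhoff) v = Pi.single v 1 +
      ∑ e with Γ.tgt e = v, Γ.weight e • (Pi.single v 1 - Pi.single (Γ.src e) 1 : V → ℝ) := by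
  classical
  have hw : ∀ u, Γ.arcWeight u v =
      ∑ e with Γ.tgt e = v, Γ.weight e * (Pi.single (Γ.src e) 1 : V → ℝ) u := by
    intro u
    simp only [arcWeight, Finset.sum_filter, Pi.single_apply, mul_ite, mul_one, mul_zero,
      ← ite_and]
    exact Finset.sum_congr rfl fun e _ => if_congr (by grind) rfl rfl
  funext u
  have hone : (1 : Matrix V V ℝ) v u = (Pi.single v 1 : V → ℝ) u := by
    simp [one_apply, Pi.single_apply, eq_comm]
  simp only [Matrix.add_apply, Pi.add_apply, hone, Finset.sum_apply, Pi.smul_apply, smul_eq_mul,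
    Pi.sub_apply, mul_sub, Finset.sum_sub_distrib, ← hw]
  congr 1
  by_cases huv : v = u
  · subst huv
    have htot : ∑ e with Γ.tgt e = v, Γ.weight e = ∑ k, Γ.arcWeight k v := by
      simp only [hw]
      rw [Finset.sum_comm]
      refine Finset.sum_congr rfl fun e _ => ?_
      rw [← Finset.mul_sum]
      simp
    simp only [kirchhoff, of_apply, if_true, Pi.single_eq_same, mul_one, htot,
      Finset.sum_neg_distrib, neg_neg]
    rw [Finset.filter_ne' , ← Finset.add_sum_erase _ _ (Finset.mem_univ v)]
    ring
  · simp [kirchhoff, huv, Ne.symm huv]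

open Classical in
/-- The arc choices that select no arc for the vertex `i`. -/
noncomputable def arcChoices (Γ : WeightedMultidigraph V E) (i : V) : Finset (V → Option E) :=
  Fintype.piFinset fun v =>
    if v = i then {none} else Finset.insertNone {e | Γ.tgt e = v}

lemma mem_arcChoices {i : V} : c ∈ Γ.arcChoices i ↔ Γ.IsArcChoice c ∧ c i = none := by
  simp only [arcChoices, Fintype.mem_piFinset, IsArcChoice]
  constructor
  · intro h
    have hi : c i = none := by simpa using h i
    refine ⟨fun v e he => ?_, hi⟩
    have hv : v ≠ i := by
      rintro rfl
      simp [hi] at he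
    simpa [hv, he] using h v
  · rintro ⟨h, hi⟩ v
    split_ifs with hv
    · simpa [hv] using hi
    · rw [Finset.mem_insertNone]
      intro e he
      simpa using h v e he

lemma adjugate_one_add_kirchhoff (i j : V) :
    (1 + Γ.kirchhoff).adjugate j i =
      ∑ c ∈ Γ.arcChoices i, (∏ v, (c v).elim 1 Γ.weight) * (Γ.choiceMatrix c).adjugate j i := by
  classical
  let g : V → Option E → V → ℝ := fun v o =>
    if v = i then Pi.single j 1
    else o.elim 1 Γ.weight • (Pi.single v 1 - o.elim 0 fun e => Pi.single (Γ.src e) 1)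
  have hrow : (1 + Γ.kirchhoff).updateRow i (Pi.single j 1) = fun v =>
      ∑ o ∈ (if v = i then {none} else Finset.insertNone {e | Γ.tgt e = v}), g v o := by
    funext v
    by_cases hv : v = i
    · subst hv
      simp [g]
    · rw [updateRow_ne hv, one_add_kirchhoff_apply]
      simp [g, hv, Finset.sum_insertNone]
  rw [adjugate_apply, hrow]
  change detRowAlternating.toMultilinearMap _ = _
  rw [MultilinearMap.map_sum_finset]
  refine Finset.sum_congr rfl fun c hcm => ?_
  have hi : c i = none := (mem_arcChoices.1 hcm).2
  rw [adjugate_apply, ← det_mul_column]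
  change det _ = _
  congr 1
  funext v u
  by_cases hv : v = i
  · subst hv
    simp [g, hi]
  · simp [g, hv, choiceMatrix]

theorem adjugate_one_add_kirchhoff_eq_totalWeight (i j : V) :
    (1 + Γ.kirchhoff).adjugate j i = Γ.totalWeight (Γ.divergingForests i j) := by
  classical
  rw [adjugate_one_add_kirchhoff]
  have hterm : ∀ c ∈ Γ.arcChoices i,
      (∏ v, (c v).elim 1 Γ.weight) * (Γ.choiceMatrix c).adjugate j i =
        if Γ.IsGrounded c ∧ Γ.Reaches (Γ.chosenArcs c) i j then
          Γ.subgraphWeight (Γ.chosenArcs c) else 0 := by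
    intro c hcm
    obtain ⟨hc, hi⟩ := mem_arcChoices.1 hcm
    rw [adjugate_choiceMatrix hc hi, hc.subgraphWeight_chosenArcs, mul_ite, mul_one, mul_zero]
  rw [Finset.sum_congr rfl hterm, ← Finset.sum_filter, totalWeight]
  refine Finset.sum_bij (fun c _ => (Γ.chosenArcs c, choiceRoots c)) ?_ ?_ ?_ fun _ _ => rfl
  · intro c hcm
    obtain ⟨hcm, hg, hr⟩ := Finset.mem_filter.1 hcm
    exact mem_divergingForests.2 ⟨hg.isDivergingForest,
      mem_choiceRoots.2 (mem_arcChoices.1 hcm).2, hr.sameComponent⟩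
  · intro c hcm c' hcm' heq
    exact (mem_arcChoices.1 (Finset.mem_filter.1 hcm).1).1.ext
      (mem_arcChoices.1 (Finset.mem_filter.1 hcm').1).1 (Prod.ext_iff.1 heq).1
  · rintro ⟨F, R⟩ hFR
    obtain ⟨hd, hi, hij⟩ := mem_divergingForests.1 hFR
    obtain ⟨c, hc, hg, rfl, rfl⟩ := hd.exists_choice
    rw [mem_choiceRoots] at hi
    exact ⟨c, Finset.mem_filter.2
      ⟨mem_arcChoices.2 ⟨hc, hi⟩, hg, hij.reaches_of_choice hi⟩, rfl⟩

end Determinants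

end WeightedMultidigraph

theorem theorem4 {n : ℕ} {E : Type*} [Fintype E] (Γ : WeightedMultidigraph (Fin (n + 1)) E)
    (i j : Fin (n + 1)) :
    cofactor (1 + Γ.kirchhoff) i j = Γ.totalWeight (Γ.divergingForests i j) := by
  rw [← WeightedMultidigraph.adjugate_one_add_kirchhoff_eq_totalWeight,
    Matrix.adjugate_fin_succ_eq_det_submatrix, cofactor]
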